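/- Let $\mathcal J$ be a finite-dimensional real Jordan algebra with (commutative) product $\{\cdot,\cdot\}$ and multiplications $l_x(y)=\{x,y\}$, and let $\tau(x,y)=\operatorname{tr} l_{\{x,y\}}$. Assume that $\mathcal J$ is positive, i.e. $\tau$ is positive definite. Write $x^\flat=\tau(x,\cdot)\in\mathcal J^\star$, let $\#$ be the inverse of the isomorphism $\flat:\mathcal J\to\mathcal J^\star$, and put $\tau^\flat(\eta,\zeta)=\tau(\eta^\#,\zeta^\#)$ on $\mathcal J^\star$. For $\xi\in\mathcal J^\star$ let $\mathcal H_\xi=\{l_x^\ast\xi\mid x\in\mathcal J\}\subset\mathcal J^\star$, where $l_x^\ast\xi=\xi\circ l_x$, with the canonical symmetric bilinear form $\mathcal G_\xi$ on $\mathcal H_\xi$ given by $\mathcal G_\xi(l_x^\ast\xi,l_y^\ast\xi)=\xi(\{x,y\})$. Let $\mathfrak g(\mathcal J)\subset\mathfrak{gl}(\mathcal J)$ be the Lie algebra generated by all $l_x$. The point $\xi$ is called regular if $\mathcal H_\xi$ equals $\{\xi\circ X\mid X\in\mathfrak g(\mathcal J)\}$, the tangent space at $\xi$ of the orbit of $\xi$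 under the structure group. Let $(c_i)_{i=1}^r$ be a Jordan frame of $\mathcal J$, i.e. nonzero primitive idempotents with $\{c_i,c_j\}=0$ for $i\ne j$ and $\sum_i c_i=\mathbf 1$, and let $$\mathcal J_{ij}=\mathcal J_{ji}=\{x\mid \{c_k,x\}=\tfrac12(\delta_{ik}+\delta_{jk})x\ \text{ for all }k\}$$ be the Peirce spaces, and $\mathcal J_{ij}^\flat$ their images under $\flat$. Let $\lambda_1,\dots,\lambda_r\in\mathbb R$ and $\xi=\sum_i\lambda_i c_i^\flat$. Below, $a,b$ denote indices with $\lambda_a\neq0$, $\lambda_b\ne0$, while $i,j$ denote arbitrary indices; sums over $\{a,i\}$ run over the unordered pairs (with $a=i$ allowed) that contain an index $a$ with $\lambda_a\ne0$. (1) If $\lambda_a+\lambda_b\neq0$ for all $a,b$ (with $\lambda_a,\lambda_b\ne0$), then $\xi$ is regular. (2) If $\xi$ is regular, then $\mathcal H_\xi=\bigoplus_{\{a,i\}}\mathcal J_{ai}^\flat$, one has $\lambda_a+\lambda_i\ne0$ whenever $\mathcal J_{ai}\neq0$, and $$\mathcal G_\xi=\sum_{\{a,i\}}\frac{2}{\lambda_a+\lambda_i}\,\tau^\flat|_{\mathcal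 J_{ai}^\flat},$$ the sum being over those pairs with $\mathcal J_{ai}\ne0$: if $\eta=\sum\eta_{ai}$ and $\zeta=\sum\zeta_{ai}$ with $\eta_{ai},\zeta_{ai}\in\mathcal J_{ai}^\flat$, then $\mathcal G_\xi(\eta,\zeta)=\sum_{\{a,i\}}\frac{2}{\lambda_a+\lambda_i}\tau^\flat(\eta_{ai},\zeta_{ai})$. Equivalently, for $x\in\mathcal J_{ai}$ and $y\in\mathcal J_{bj}$, $$\mathcal G_\xi(x^\flat,y^\flat)=\begin{cases}\dfrac{2}{\lambda_a+\lambda_i}\,\tau^\flat(x^\flat,y^\flat)&\text{if }\{a,i\}=\{b,j\}\text{ (and }\mathcal J_{ai}\neq0),\\[1mm]0&\text{else,}\end{cases}$$ so that distinct blocks are $\mathcal G_\xi$-orthogonal. -/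

import Mathlib

namespace JordanMetric

open Module

noncomputable section

section Algebra

variable {A : Type*} [NonUnitalNonAssocCommRing A] [Module ℝ A] [IsScalarTower ℝ A A]
  [SMulCommClass ℝ A A]

/-- The musical map `♯_ξ : A → A^⋆` at a point `ξ` of the dual of a commutative algebra:
`♯_ξ a = l_a^* ξ`, that is, `b ↦ ξ (a * b)`. -/
def sharpAt (ξ : Dual ℝ A) : A →ₗ[ℝ] Dual ℝ A :=
  (LinearMap.mul ℝ A).compr₂ ξ

theorem sharpAt_apply (ξ : Dual ℝ A) (a b : A) : sharpAt ξ a b = ξ (a * b) := rfl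

/-- The value `H_ξ = {l_a^* ξ | a ∈ A}` at `ξ` of the canonical distribution on `A^⋆`
(tangent spaces of the vector space `A^⋆` are identified with `A^⋆`). -/
def dualDistribution (ξ : Dual ℝ A) : Submodule ℝ (Dual ℝ A) :=
  LinearMap.range (sharpAt ξ)

theorem sharpAt_mem (ξ : Dual ℝ A) (a : A) : sharpAt ξ a ∈ dualDistribution ξ := ⟨a, rfl⟩

theorem exists_section (ξ : Dual ℝ A) :
    ∃ s : dualDistribution ξ →ₗ[ℝ] A, ∀ η, sharpAt ξ (s η) = η := by
  have : Projective ℝ (dualDistribution ξ) :=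
    letI : AddCommGroup (dualDistribution ξ) := Submodule.addCommGroup _
    Projective.of_free
  obtain ⟨s, hs⟩ := projective_lifting_property (sharpAt ξ).rangeRestrict
    (LinearMap.id : dualDistribution ξ →ₗ[ℝ] _) (sharpAt ξ).surjective_rangeRestrict
  refine ⟨s, fun η => ?_⟩
  exact congrArg Subtype.val (LinearMap.congr_fun hs η)

/-- The canonical bilinear form `G_ξ` on `H_ξ`. It is evaluated on preimages under `♯_ξ`; it does
not depend on their choice and is characterized by `G_ξ (l_a^* ξ) (l_b^* ξ) = ξ (a * b)`,
see `canonicalForm_sharpAt`. -/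
def canonicalForm (ξ : Dual ℝ A) : LinearMap.BilinForm ℝ (dualDistribution ξ) :=
  (sharpAt ξ).compl₁₂ (exists_section ξ).choose (exists_section ξ).choose

theorem canonicalForm_sharpAt (ξ : Dual ℝ A) (a b : A) :
    canonicalForm ξ ⟨sharpAt ξ a, sharpAt_mem ξ a⟩ ⟨sharpAt ξ b, sharpAt_mem ξ b⟩
      = ξ (a * b) := by
  have h := (exists_section ξ).choose_spec
  set s := (exists_section ξ).choose with hs
  have ha := h ⟨sharpAt ξ a, sharpAt_mem ξ a⟩
  have hb := h ⟨sharpAt ξ b, sharpAt_mem ξ b⟩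
  simp only [canonicalForm, ← hs, LinearMap.compl₁₂_apply]
  rw [ha, sharpAt_apply, mul_comm, ← sharpAt_apply, hb, sharpAt_apply, mul_comm]

-- `gl(A) = End A` carries the commutator bracket
attribute [local instance] LieRing.ofAssociativeRing

variable (A) in
/-- The structure Lie algebra: the Lie subalgebra of `gl(A)` generated by all multiplications. -/
def structureLieAlgebra : LieSubalgebra ℝ (End ℝ A) :=
  LieSubalgebra.lieSpan ℝ (End ℝ A) (Set.range (LinearMap.mulLeft ℝ : A → End ℝ A))

/-- The tangent space `T_ξ(G(A)·ξ) = {ξ ∘ X | X ∈ g(A)}` at `ξ` of the orbit of `ξ` under the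
dual action of the structure group, the connected group with Lie algebra `g(A)`. -/
def orbitTangent (ξ : Dual ℝ A) : Submodule ℝ (Dual ℝ A) :=
  (structureLieAlgebra A).toSubmodule.map
    ((Dual.transpose : End ℝ A →ₗ[ℝ] Dual ℝ A →ₗ[ℝ] Dual ℝ A).flip ξ)

/-- A point of the dual is regular if the canonical distribution at it is the whole tangent space
of its orbit under the structure group. -/
def IsRegularPoint (ξ : Dual ℝ A) : Prop :=
  dualDistribution ξ = orbitTangent ξ

variable (A) in
/-- The symmetric bilinear form `τ(x, y) = tr l_{x y}`. -/
def traceForm : LinearMap.BilinForm ℝ A :=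
  (LinearMap.mul ℝ A).compr₂ (LinearMap.trace ℝ A ∘ₗ LinearMap.mul ℝ A)

theorem traceForm_apply (x y : A) :
    traceForm A x y = LinearMap.trace ℝ A (LinearMap.mulLeft ℝ (x * y)) := rfl

theorem traceForm_comm (x y : A) : traceForm A x y = traceForm A y x := by
  rw [traceForm_apply, traceForm_apply, mul_comm]

variable (A) in
/-- `A` is positive: the form `τ` is positive definite. -/
def IsPositive : Prop := ∀ x : A, x ≠ 0 → 0 < traceForm A x x

theorem IsPositive.nondegenerate (h : IsPositive A) : (traceForm A).Nondegenerate := by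
  constructor
  · intro x hx
    by_contra hne
    exact (h x hne).ne' (hx x)
  · intro x hx
    by_contra hne
    exact (h x hne).ne' (hx x)

/-- A primitive idempotent: a nonzero idempotent that is not the sum of two nonzero idempotents. -/
def IsPrimitiveIdempotent (c : A) : Prop :=
  IsIdempotentElem c ∧ c ≠ 0 ∧
    ∀ d e : A, IsIdempotentElem d → IsIdempotentElem e → c = d + e → d = 0 ∨ e = 0

/-- A Jordan frame: pairwise orthogonal primitive idempotents whose sum is the identity element. -/
structure IsJordanFrame {r : ℕ} (c : Fin r → A) : Prop where
  primitive : ∀ i, IsPrimitiveIdempotent (c i)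
  orthogonal : ∀ i j, i ≠ j → c i * c j = 0
  sum_mul : ∀ x, (∑ i, c i) * x = x

/-- The Peirce space `J_{ij}` (with `J_{ij} = J_{ji}`): the joint eigenspace of the multiplications
by the `c_k` on which `l_{c_k}` is the scalar `(δ_{ik} + δ_{jk}) / 2`. -/
def peirceSpace {r : ℕ} (c : Fin r → A) (i j : Fin r) : Submodule ℝ A where
  carrier := {x | ∀ k, c k * x = (((if i = k then 1 else 0) + (if j = k then 1 else 0)) / 2 : ℝ) • x}
  add_mem' {x y} hx hy k := by rw [mul_add, hx k, hy k, smul_add]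
  zero_mem' k := by rw [mul_zero, smul_zero]
  smul_mem' t x hx k := by rw [mul_smul_comm, hx k, smul_comm]

variable [FiniteDimensional ℝ A]

/-- The isomorphism `♭ : A → A^⋆`, `x^♭ = τ(x, ·)`, of a positive algebra; its inverse is `#`. -/
def flat (h : IsPositive A) : A ≃ₗ[ℝ] Dual ℝ A :=
  LinearMap.BilinForm.toDual (traceForm A) h.nondegenerate

theorem flat_apply (h : IsPositive A) (x y : A) : flat h x y = traceForm A x y := by
  simp [flat, LinearMap.BilinForm.toDual_def]

/-- The dual `τ^♭(η, ζ) = τ(η^#, ζ^#)` of `τ`, a bilinear form on `A^⋆`. -/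
def dualTraceForm (h : IsPositive A) : LinearMap.BilinForm ℝ (Dual ℝ A) :=
  (traceForm A).compl₁₂ (flat h).symm.toLinearMap (flat h).symm.toLinearMap

theorem dualTraceForm_flat (h : IsPositive A) (x y : A) :
    dualTraceForm h (flat h x) (flat h y) = traceForm A x y := by
  simp [dualTraceForm]

/-- The dual Peirce space `J_{ij}^♭`. -/
def dualPeirceSpace (h : IsPositive A) {r : ℕ} (c : Fin r → A) (i j : Fin r) :
    Submodule ℝ (Dual ℝ A) :=
  (peirceSpace c i j).map (flat h).toLinearMap

end Algebra

open Classical in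
/-- The unordered index pairs, written as pairs `(i, j)` with `i ≤ j`, that contain an
index `a` with `λ_a ≠ 0`. -/
def activePairs {r : ℕ} (lam : Fin r → ℝ) : Finset (Fin r × Fin r) :=
  {p | p.1 ≤ p.2 ∧ (lam p.1 ≠ 0 ∨ lam p.2 ≠ 0)}

end

end JordanMetric

/-! Put `z = ∑ λ_a c_a`, so that `ξ = z^♭`. Since `τ` is associative (`traceForm_mul`), `l_x^* ξ =
(z x)^♭`; thus `♭` identifies `H_ξ` with the range of `l_z`, and `G_ξ` becomes `(z x, z y) ↦ τ(z x,
y)`. The Peirce spaces span `J`, are `τ`-orthogonal, and `l_z` is the scalar `(λ_i + λ_j)/2` on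
`J_ij`. Inverting it blockwise yields `H_ξ` and the coefficients `2/(λ_a + λ_i)`, provided no
nonzero block has `λ_a = -λ_i ≠ 0`.

Regularity excludes such blocks: for `w` in one of them, the tangent vector `ξ ∘ [l_{c_a}, l_w]`
takes the value `λ_a τ(w, w)/2` at `w`, but must vanish on `ker l_z`.

Conversely, under the spectral condition `ker l_z` is the sum of the `J_ij` with `λ_i = λ_j = 0`.
Every element of `g(J)` is a multiplication plus a derivation, and for both parts `ξ ∘ X` vanishes
on this kernel, hence lies in `H_ξ`. -/

namespace JordanMetric

open Module

/-! ### Peirce components -/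

section Components

variable {A : Type*} [NonUnitalNonAssocCommRing A] [Module ℝ A] [SMulCommClass ℝ A A]
  {r : ℕ} {c : Fin r → A}

variable (c) in
/-- The components of an element in the Peirce spaces; the off-diagonal components are split
evenly among the two orderings of the index pair. -/
def peirceComponent (i j : Fin r) : A →ₗ[ℝ] A :=
  (2 : ℝ) • (LinearMap.mulLeft ℝ (c i) * LinearMap.mulLeft ℝ (c j))
    - if i = j then LinearMap.mulLeft ℝ (c i) else 0

theorem peirceComponent_self (i : Fin r) (x : A) :
    peirceComponent c i i x = (2 : ℝ) • (c i * (c i * x)) - c i * x := by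
  simp [peirceComponent]

theorem peirceComponent_of_ne {i j : Fin r} (h : i ≠ j) (x : A) :
    peirceComponent c i j x = (2 : ℝ) • (c i * (c j * x)) := by
  simp [peirceComponent, h]

theorem sum_peirceComponent (hc : IsJordanFrame c) (x : A) :
    ∑ i, ∑ j, peirceComponent c i j x = x := by
  have h (i : Fin r) : ∑ j, peirceComponent c i j x = c i * x := by
    simp only [peirceComponent, LinearMap.sub_apply, Finset.sum_sub_distrib, LinearMap.smul_apply,
      Module.End.mul_apply, LinearMap.mulLeft_apply, ← Finset.smul_sum, ← Finset.mul_sum,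
      ← Finset.sum_mul, hc.sum_mul]
    rw [Finset.sum_eq_single i (by intro j _ hj; rw [if_neg hj.symm]; rfl) (by simp), if_pos rfl]
    rw [LinearMap.mulLeft_apply]
    module
  simp only [h, ← Finset.sum_mul, hc.sum_mul]

theorem peirceSpace_comm (i j : Fin r) : peirceSpace c i j = peirceSpace c j i := by
  ext x
  exact forall_congr' fun k => by rw [add_comm]

end Components

/-! ### Jordan identities, Peirce decomposition and associativity of the trace form -/

section Jordan

variable {A : Type*} [NonUnitalNonAssocCommRing A] [IsCommJordan A]

/-- The fully linearized Jordan identity, solved for the multiplication by a triple product. -/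
theorem triple_mul [Module ℝ A] (a b x y : A) :
    a * b * x * y = a * x * (b * y) + b * x * (a * y) + a * b * (x * y)
      - a * (x * (b * y)) - b * (x * (a * y)) := by
  have h : (2 : ℕ) • (a * (b * y * x) - b * y * (a * x) + (b * (y * a * x) - y * a * (b * x))
      + (y * (a * b * x) - a * b * (y * x))) = 0 :=
    DFunLike.congr_fun (two_nsmul_lie_lmul_lmul_add_add_eq_zero a b y) x
  rw [two_nsmul, ← two_smul ℝ] at h
  have h' := (smul_eq_zero.mp h).resolve_left two_ne_zero
  rw [mul_comm y (a * b * x), mul_comm (b * y) (a * x), mul_comm y a, mul_comm (a * y) (b * x),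
    mul_comm (b * y) x, mul_comm (a * y) x, mul_comm y x] at h'
  rw [← sub_eq_zero, ← h']
  abel

/-- The commutator of two multiplications of a Jordan algebra is a derivation. -/
theorem commutator_mul [Module ℝ A] (a b x y : A) :
    a * (b * (x * y)) - b * (a * (x * y)) =
      (a * (b * x) - b * (a * x)) * y + x * (a * (b * y) - b * (a * y)) := by
  have h1 := triple_mul b x a y
  have h2 := triple_mul a x b y
  rw [mul_comm (b * x) a] at h1
  rw [mul_comm (a * x) b] at h2
  rw [sub_mul, mul_sub, h1, h2, mul_comm b a, mul_comm x a, mul_comm x b]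
  abel

/-- Multiplications by an idempotent and by an element it annihilates commute. -/
theorem mul_left_comm_of_mul_eq_zero [Module ℝ A] {e w : A} (he : IsIdempotentElem e)
    (hw : e * w = 0) (x : A) : e * (w * x) = w * (e * x) := by
  have h := triple_mul e w x e
  rw [mul_comm w e, hw, he.eq] at h
  simp only [zero_mul, mul_zero, zero_add, sub_zero, add_zero] at h
  rwa [mul_comm x e, mul_comm (w * x) e, eq_comm, sub_eq_zero] at h

theorem IsJordanFrame.mul_left_comm [Module ℝ A] {r : ℕ} {c : Fin r → A}
    (hc : IsJordanFrame c) (i j : Fin r) (x : A) :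
    c i * (c j * x) = c j * (c i * x) := by
  rcases eq_or_ne i j with rfl | h
  · rfl
  · exact mul_left_comm_of_mul_eq_zero (hc.primitive i).1 (hc.orthogonal i j h) x

theorem mulLeft_triple [Module ℝ A] [SMulCommClass ℝ A A] (a b x : A) :
    LinearMap.mulLeft ℝ (a * b * x) =
      LinearMap.mulLeft ℝ (a * x) * LinearMap.mulLeft ℝ b
      + LinearMap.mulLeft ℝ (b * x) * LinearMap.mulLeft ℝ a
      + LinearMap.mulLeft ℝ (a * b) * LinearMap.mulLeft ℝ x
      - LinearMap.mulLeft ℝ a * (LinearMap.mulLeft ℝ x * LinearMap.mulLeft ℝ b)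
      - LinearMap.mulLeft ℝ b * (LinearMap.mulLeft ℝ x * LinearMap.mulLeft ℝ a) := by
  ext y
  exact triple_mul a b x y

variable [Module ℝ A] {r : ℕ} {c : Fin r → A}

/-- The cubic identity satisfied by the multiplication by an idempotent. -/
theorem idempotent_mul_mul_mul {e : A} (he : IsIdempotentElem e) (x : A) :
    (2 : ℝ) • (e * (e * (e * x))) = (3 : ℝ) • (e * (e * x)) - e * x := by
  have h := triple_mul e e e x
  simp only [he.eq] at h
  rw [← sub_eq_zero] at h
  rw [eq_sub_iff_add_eq, ← sub_eq_zero, ← h]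
  module

/-- Says that `c k` kills the `(i, i)` component: in the linearized Jordan identity for `c i, c i, c
k` all products of `c i` with `c k` drop out. -/
theorem IsJordanFrame.mul_mul_mul_self (hc : IsJordanFrame c) {i k : Fin r} (h : k ≠ i) (x : A) :
    (2 : ℝ) • (c k * (c i * (c i * x))) = c k * (c i * x) := by
  have e := triple_mul (c i) (c i) (c k) x
  rw [(hc.primitive i).1.eq, hc.orthogonal i k h.symm, zero_mul, zero_mul,
    hc.mul_left_comm i k, hc.mul_left_comm i k] at e
  rw [eq_comm, ← sub_eq_zero, e]
  module

theorem IsJordanFrame.mul_mul_mul_eq_zero (hc : IsJordanFrame c) {i j k : Fin r} (hij : i ≠ j)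
    (hi : k ≠ i) (hj : k ≠ j) (x : A) : c k * (c i * (c j * x)) = 0 := by
  have e := triple_mul (c i) (c j) (c k) x
  rw [hc.orthogonal i j hij, hc.orthogonal i k hi.symm, hc.orthogonal j k hj.symm, zero_mul,
    zero_mul, zero_mul, hc.mul_left_comm i k, hc.mul_left_comm j k, hc.mul_left_comm j i] at e
  have e' : (2 : ℝ) • (c k * (c i * (c j * x))) = 0 := by
    rw [← neg_eq_zero, ← zero_mul (c k * x), ← zero_mul x]
    simp only [zero_mul] at e ⊢
    rw [e]
    module
  exact (smul_eq_zero.mp e').resolve_left two_ne_zero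

variable [SMulCommClass ℝ A A]

/-- The commuting operators `l_{c_k}` have eigenvalues in `{0, 1/2, 1}`. The polynomial `2t² - t` is
`1` at `1` and zero at the others, while `2st` is `1/2` at `s = t = 1/2`, half of the off-diagonal
projection. -/
theorem peirceComponent_mem (hc : IsJordanFrame c) (i j : Fin r) (x : A) :
    peirceComponent c i j x ∈ peirceSpace c i j := by
  intro k
  rcases eq_or_ne i j with rfl | hij
  · rw [peirceComponent_self, mul_sub, mul_smul_comm]
    rcases eq_or_ne i k with rfl | hik
    · rw [idempotent_mul_mul_mul (hc.primitive i).1, if_pos rfl]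
      module
    · rw [hc.mul_mul_mul_self hik.symm, if_neg hik]
      simp
  · rw [peirceComponent_of_ne hij, mul_smul_comm]
    rcases eq_or_ne i k with rfl | hik
    · rw [hc.mul_left_comm i j, hc.mul_left_comm i j, hc.mul_mul_mul_self hij.symm, if_pos rfl,
        if_neg hij.symm]
      module
    · rcases eq_or_ne j k with rfl | hjk
      · rw [hc.mul_left_comm j i, if_pos rfl, if_neg hik, hc.mul_mul_mul_self hij]
        module
      · rw [hc.mul_mul_mul_eq_zero hij hik.symm hjk.symm, if_neg hik, if_neg hjk]
        simp

variable [IsScalarTower ℝ A A]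

/-- The trace form of a Jordan algebra is associative. -/
theorem traceForm_mul (x a b : A) : traceForm A (x * a) b = traceForm A a (x * b) := by
  rw [traceForm_apply, traceForm_apply, mul_comm a (x * b), mulLeft_triple x a b,
    mulLeft_triple x b a]
  set X := LinearMap.mulLeft ℝ x
  set Y := LinearMap.mulLeft ℝ a
  set Z := LinearMap.mulLeft ℝ b
  rw [mul_comm b a]
  simp only [map_add, map_sub]
  -- The two expansions share their terms with two factors; those with three factors have equal
  -- traces by cyclicity.
  have h1 : LinearMap.trace ℝ A (X * (Z * Y)) = LinearMap.trace ℝ A (Y * (X * Z)) := by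
    rw [← mul_assoc, LinearMap.trace_mul_comm]
  have h2 : LinearMap.trace ℝ A (X * (Y * Z)) = LinearMap.trace ℝ A (Z * (X * Y)) := by
    rw [← mul_assoc, LinearMap.trace_mul_comm]
  have h3 : LinearMap.trace ℝ A (Y * (Z * X)) = LinearMap.trace ℝ A (X * (Y * Z)) := by
    rw [← mul_assoc, LinearMap.trace_mul_comm]
  have h4 : LinearMap.trace ℝ A (Z * (Y * X)) = LinearMap.trace ℝ A (X * (Z * Y)) := by
    rw [← mul_assoc, LinearMap.trace_mul_comm]
  have h5 := LinearMap.trace_mul_comm ℝ (LinearMap.mulLeft ℝ (x * b)) Y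
  linarith

theorem traceForm_peirceComponent (hc : IsJordanFrame c) (i j : Fin r) (x y : A) :
    traceForm A (peirceComponent c i j x) y = traceForm A x (peirceComponent c i j y) := by
  rcases eq_or_ne i j with rfl | hij
  · simp only [peirceComponent_self, map_sub, map_smul, LinearMap.sub_apply, LinearMap.smul_apply,
      traceForm_mul]
  · simp only [peirceComponent_of_ne hij, map_smul, LinearMap.smul_apply, traceForm_mul,
      hc.mul_left_comm i j]

/-- Distinct Peirce spaces are orthogonal. -/
theorem traceForm_eq_zero_of_mem_peirceSpace {i j k l : Fin r} (h : s(i, j) ≠ s(k, l)) {x y : A}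
    (hx : x ∈ peirceSpace c i j) (hy : y ∈ peirceSpace c k l) : traceForm A x y = 0 := by
  by_contra hne
  -- Each `l_{c_m}` is self-adjoint, so a nonzero pairing forces equal eigenvalues, and these
  -- determine the unordered index pair.
  have key (m : Fin r) : (((if i = m then 1 else 0) + (if j = m then 1 else 0)) : ℝ)
      = (if k = m then 1 else 0) + (if l = m then 1 else 0) := by
    have e := traceForm_mul (c m) x y
    rw [hx m, hy m, map_smul, LinearMap.smul_apply, map_smul, smul_eq_mul, smul_eq_mul] at e
    have := mul_right_cancel₀ hne e
    linarith
  apply h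
  rw [Sym2.eq_iff]
  have ki := key i
  have kj := key j
  by_cases hij : i = j
  · subst hij
    by_cases h1 : k = i <;> by_cases h2 : l = i <;> simp [h1, h2] at ki ⊢
  · by_cases h1 : k = i <;> by_cases h2 : l = i <;> by_cases h3 : k = j <;> by_cases h4 : l = j <;>
      simp_all

end Jordan

theorem mem_activePairs {r : ℕ} {lam : Fin r → ℝ} {p : Fin r × Fin r} :
    p ∈ activePairs lam ↔ p.1 ≤ p.2 ∧ (lam p.1 ≠ 0 ∨ lam p.2 ≠ 0) := by
  simp [activePairs]

theorem eq_of_sym2_eq_of_mem_activePairs {r : ℕ} {lam : Fin r → ℝ} {p q : Fin r × Fin r}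
    (hp : p ∈ activePairs lam) (hq : q ∈ activePairs lam) (h : s(p.1, p.2) = s(q.1, q.2)) :
    p = q := by
  rcases Sym2.mk_eq_mk_iff.mp h with h | h
  · exact h
  · have h1 : p.1 = q.2 := congrArg Prod.fst h
    have h2 : p.2 = q.1 := congrArg Prod.snd h
    have hp' := (mem_activePairs.mp hp).1
    have hq' := (mem_activePairs.mp hq).1
    rw [h1, h2] at hp'
    have := le_antisymm hp' hq'
    exact Prod.ext (h1.trans this) (h2.trans this.symm)

attribute [local instance] LieRing.ofAssociativeRing

/-! ### The structure algebra inside multiplications plus derivations -/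

section StructureAlgebra

variable {A : Type*} [NonUnitalNonAssocCommRing A] [Module ℝ A] [SMulCommClass ℝ A A]

theorem mulLeft_mem_structureLieAlgebra (a : A) :
    LinearMap.mulLeft ℝ a ∈ structureLieAlgebra A :=
  LieSubalgebra.subset_lieSpan ⟨a, rfl⟩

theorem mem_orbitTangent {ξ η : Dual ℝ A} :
    η ∈ orbitTangent ξ ↔ ∃ X ∈ structureLieAlgebra A, ξ ∘ₗ X = η := Iff.rfl

variable [IsCommJordan A]

variable (A) in
/-- The Lie algebra of all sums of a multiplication and a derivation of a Jordan algebra. -/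
def mulDerivationAlgebra : LieSubalgebra ℝ (End ℝ A) where
  carrier := {X | ∃ (a : A) (D : End ℝ A), (∀ x y, D (x * y) = D x * y + x * D y) ∧
    X = LinearMap.mulLeft ℝ a + D}
  zero_mem' := ⟨0, 0, by simp, by ext; simp⟩
  add_mem' := by
    rintro _ _ ⟨a, D, hD, rfl⟩ ⟨b, E, hE, rfl⟩
    refine ⟨a + b, D + E, fun x y => ?_, ?_⟩
    · simp only [LinearMap.add_apply, hD, hE, add_mul, mul_add]
      abel
    · ext x
      simp only [LinearMap.add_apply, LinearMap.mulLeft_apply, add_mul]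
      abel
  smul_mem' := by
    rintro t _ ⟨a, D, hD, rfl⟩
    refine ⟨t • a, t • D, fun x y => ?_, ?_⟩
    · simp only [LinearMap.smul_apply, hD, smul_add, mul_smul_comm]
      rw [mul_comm (t • D x) y, mul_smul_comm, mul_comm y]
    · ext x
      simp only [LinearMap.add_apply, LinearMap.smul_apply, LinearMap.mulLeft_apply, smul_add]
      rw [mul_comm (t • a) x, mul_smul_comm, mul_comm x]
  lie_mem' := by
    rintro _ _ ⟨a, D, hD, rfl⟩ ⟨b, E, hE, rfl⟩
    -- For a derivation `[D, l_b] = l_{D b}`, and `[l_a, l_b]` is itself a derivation.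
    refine ⟨D b - E a, ⁅LinearMap.mulLeft ℝ a, LinearMap.mulLeft ℝ b⁆ + ⁅D, E⁆,
      fun x y => ?_, ?_⟩
    · have h := commutator_mul a b x y
      simp only [LinearMap.add_apply, Ring.lie_def, LinearMap.sub_apply, Module.End.mul_apply,
        LinearMap.mulLeft_apply]
      rw [h]
      simp only [hD, hE, map_add, add_mul, mul_add, sub_mul, mul_sub]
      abel
    · ext x
      simp only [LinearMap.add_apply, Ring.lie_def, LinearMap.sub_apply, Module.End.mul_apply,
        LinearMap.mulLeft_apply, hD, hE, sub_mul, mul_add]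
      abel

theorem structureLieAlgebra_le_mulDerivationAlgebra :
    structureLieAlgebra A ≤ mulDerivationAlgebra A := by
  refine LieSubalgebra.lieSpan_le.mpr ?_
  rintro _ ⟨a, rfl⟩
  exact ⟨a, 0, by simp, by simp⟩

end StructureAlgebra

theorem sum_smul_mul_self {A : Type*} [NonUnitalNonAssocCommRing A] [Module ℝ A]
    [SMulCommClass ℝ A A] {r : ℕ} {c : Fin r → A} {lam : Fin r → ℝ} (hc : IsJordanFrame c) (a : Fin r) :
    c a * (∑ b, lam b • c b) = lam a • c a := by
  rw [Finset.mul_sum, Finset.sum_eq_single a]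
  · rw [mul_smul_comm, (hc.primitive a).1.eq]
  · intro b _ hb
    rw [mul_smul_comm, hc.orthogonal a b hb.symm, smul_zero]
  · simp

/-! ### Transfer to `J` and the regularity criterion -/

section Regular

variable {A : Type*} [NonUnitalNonAssocCommRing A] [Module ℝ A] [IsScalarTower ℝ A A]
  [SMulCommClass ℝ A A]

theorem dualDistribution_le_orbitTangent (ξ : Dual ℝ A) :
    dualDistribution ξ ≤ orbitTangent ξ := by
  rintro _ ⟨a, rfl⟩
  exact mem_orbitTangent.mpr ⟨_, mulLeft_mem_structureLieAlgebra a, rfl⟩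

variable {r : ℕ} {c : Fin r → A} {lam : Fin r → ℝ}

theorem sum_smul_mul_of_mem_peirceSpace {i j : Fin r} {x : A} (hx : x ∈ peirceSpace c i j) :
    (∑ a, lam a • c a) * x = ((lam i + lam j) / 2) • x := by
  have h (a : Fin r) : lam a • c a * x = (lam a * (((if i = a then 1 else 0) +
      (if j = a then 1 else 0)) / 2)) • x := by
    rw [smul_mul_assoc, hx a, smul_smul]
  simp only [Finset.sum_mul, h, ← Finset.sum_smul]
  congr 1
  simp [mul_div_assoc', mul_add, ← Finset.sum_div, Finset.sum_add_distrib]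

theorem sum_smul_mul_two_div_smul {i j : Fin r} {x : A} (hx : x ∈ peirceSpace c i j)
    (h : lam i + lam j = 0 → x = 0) :
    (∑ a, lam a • c a) * ((2 / (lam i + lam j)) • x) = x := by
  rw [mul_smul_comm, sum_smul_mul_of_mem_peirceSpace hx, smul_smul]
  -- Here `2 / 0 = 0` is harmless, since `x = 0`.
  by_cases h0 : lam i + lam j = 0
  · simp [h h0]
  · rw [div_mul_div_comm, mul_comm, div_self (by positivity), one_smul]

theorem IsPositive.eq_zero (hA : IsPositive A) {x : A} (h : traceForm A x x = 0) : x = 0 := by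
  by_contra hx
  exact (hA x hx).ne' h

variable [IsCommJordan A]

/-- An element orthogonal to the kernel of the multiplication by `∑ λ_a c_a` lies in its range. -/
theorem exists_sum_smul_mul_eq (hA : IsPositive A) (hc : IsJordanFrame c) {u : A}
    (hu : ∀ i j, lam i + lam j = 0 → ∀ w ∈ peirceSpace c i j, traceForm A u w = 0) :
    ∃ v, (∑ a, lam a • c a) * v = u := by
  refine ⟨∑ i, ∑ j, (2 / (lam i + lam j)) • peirceComponent c i j u, ?_⟩
  conv_rhs => rw [← sum_peirceComponent hc u]
  simp only [Finset.mul_sum]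
  refine Finset.sum_congr rfl fun i _ => Finset.sum_congr rfl fun j _ => ?_
  refine sum_smul_mul_two_div_smul (peirceComponent_mem hc i j u) fun h => hA.eq_zero ?_
  -- Moving one self-adjoint component map across pairs `u` with an element of a block in the
  -- kernel.
  rw [traceForm_peirceComponent hc]
  exact hu i j h _ (peirceComponent_mem hc i j _)

/-- A derivation moves the elements annihilated by an idempotent `e` orthogonally to `e`. -/
theorem traceForm_derivation_eq_zero {e w : A} (he : IsIdempotentElem e) (hw : e * w = 0)
    {D : End ℝ A} (hD : ∀ x y, D (x * y) = D x * y + x * D y) : traceForm A e (D w) = 0 := by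
  have h := hD e w
  rw [hw, map_zero, eq_comm, add_comm, add_eq_zero_iff_eq_neg] at h
  rw [← he.eq, traceForm_mul, h, mul_comm, map_neg, ← traceForm_mul, mul_comm, hw]
  simp

variable [FiniteDimensional ℝ A]

theorem sharpAt_flat (hA : IsPositive A) (z x : A) :
    sharpAt (flat hA z) x = flat hA (z * x) := by
  ext y
  rw [sharpAt_apply, flat_apply, flat_apply, mul_comm z, traceForm_mul]

theorem mem_dualDistribution_flat (hA : IsPositive A) {z : A} {η : Dual ℝ A} :
    η ∈ dualDistribution (flat hA z) ↔ ∃ x, flat hA (z * x) = η := by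
  simp only [← sharpAt_flat]
  rfl

theorem canonicalForm_flat (hA : IsPositive A) {z x y : A}
    {η ζ : dualDistribution (flat hA z)} (hη : (η : Dual ℝ A) = flat hA (z * x))
    (hζ : (ζ : Dual ℝ A) = flat hA (z * y)) :
    canonicalForm (flat hA z) η ζ = traceForm A (z * x) y := by
  obtain ⟨η, h1⟩ := η
  obtain ⟨ζ, h2⟩ := ζ
  simp only [← sharpAt_flat] at hη hζ
  subst hη hζ
  rw [canonicalForm_sharpAt, flat_apply, mul_comm z x, traceForm_mul]

theorem isRegularPoint_of_add_ne_zero (hA : IsPositive A) (hc : IsJordanFrame c)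
    (hlam : ∀ a b, lam a ≠ 0 → lam b ≠ 0 → lam a + lam b ≠ 0) :
    IsRegularPoint (flat hA (∑ a, lam a • c a)) := by
  refine le_antisymm (dualDistribution_le_orbitTangent _) fun η hη => ?_
  obtain ⟨X, hX, rfl⟩ := mem_orbitTangent.mp hη
  obtain ⟨a, D, hD, rfl⟩ := structureLieAlgebra_le_mulDerivationAlgebra hX
  obtain ⟨u, hu⟩ := (flat hA).surjective
    (flat hA (∑ a, lam a • c a) ∘ₗ (LinearMap.mulLeft ℝ a + D))
  rw [← hu, mem_dualDistribution_flat]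
  suffices ∃ v, (∑ a, lam a • c a) * v = u from this.imp fun v hv => by rw [hv]
  refine exists_sum_smul_mul_eq hA hc fun i j hij w hw => ?_
  -- A zero sum `λ_i + λ_j` with `λ_i ≠ 0` would make `λ_j` nonzero too, against the spectral
  -- condition.
  have hi : lam i = 0 := by
    by_contra hi
    exact hlam i j hi (fun hj => hi (by simpa [hj] using hij)) hij
  have hj : lam j = 0 := by simpa [hi] using hij
  rw [← flat_apply hA, hu, LinearMap.comp_apply, flat_apply, map_sum, LinearMap.sum_apply]
  refine Finset.sum_eq_zero fun k _ => ?_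
  rw [map_smul, LinearMap.smul_apply]
  by_cases hk : lam k = 0
  · rw [hk, zero_smul]
  have hkw : c k * w = 0 := by
    have hik : i ≠ k := fun h => hk (h ▸ hi)
    have hjk : j ≠ k := fun h => hk (h ▸ hj)
    rw [hw k, if_neg hik, if_neg hjk]
    simp
  rw [LinearMap.add_apply, LinearMap.mulLeft_apply, map_add,
    traceForm_derivation_eq_zero (hc.primitive k).1 hkw hD, mul_comm a, ← traceForm_mul,
    mul_comm w, hkw]
  simp

/-- At a regular point the blocks on which the denominators vanish are zero. -/
theorem IsRegularPoint.eq_zero_of_mem_peirceSpace (hA : IsPositive A) (hc : IsJordanFrame c)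
    (hreg : IsRegularPoint (flat hA (∑ a, lam a • c a))) {a i : Fin r} (ha : lam a ≠ 0)
    (hai : lam a + lam i = 0) {w : A} (hw : w ∈ peirceSpace c a i) : w = 0 := by
  set z := ∑ a, lam a • c a with hz
  have hne : i ≠ a := by
    rintro rfl
    exact ha (by linarith)
  have hzw : z * w = 0 := by
    rw [hz, sum_smul_mul_of_mem_peirceSpace hw, hai, zero_div, zero_smul]
  -- Evaluated at `w`, this bracket leaves `λ_a τ(c_a, w w) = λ_a τ(w, w)/2`, because the other term
  -- contains `z w = 0`.
  have hX : ⁅LinearMap.mulLeft ℝ (c a), LinearMap.mulLeft ℝ w⁆ ∈ structureLieAlgebra A :=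
    (structureLieAlgebra A).lie_mem (mulLeft_mem_structureLieAlgebra _)
      (mulLeft_mem_structureLieAlgebra _)
  have hmem := (mem_orbitTangent (ξ := flat hA z)).mpr ⟨_, hX, rfl⟩
  rw [← show dualDistribution _ = _ from hreg, mem_dualDistribution_flat] at hmem
  obtain ⟨u, hu⟩ := hmem
  have h := LinearMap.congr_fun hu w
  rw [flat_apply, mul_comm, mul_comm u z, traceForm_mul, hzw, LinearMap.comp_apply, flat_apply,
    Ring.lie_def, LinearMap.sub_apply, Module.End.mul_apply, Module.End.mul_apply] at h
  simp only [LinearMap.mulLeft_apply, map_sub, map_zero] at h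
  rw [← traceForm_mul w z, mul_comm w z, hzw, ← traceForm_mul (c a) z, sum_smul_mul_self hc,
    map_smul, LinearMap.smul_apply, ← traceForm_mul w, mul_comm w, hw a, if_pos rfl,
    if_neg hne, map_smul] at h
  simp only [map_zero, LinearMap.zero_apply, LinearMap.smul_apply, smul_eq_mul] at h
  refine hA.eq_zero ?_
  have : lam a * traceForm A w w = 0 := by linarith
  exact (mul_eq_zero.mp this).resolve_left ha

/-- Mutually orthogonal subspaces are independent, as `τ` is definite. -/
theorem iSupIndep_dualPeirceSpace (hA : IsPositive A) (c : Fin r → A) (lam : Fin r → ℝ) :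
    iSupIndep fun p : activePairs lam => dualPeirceSpace hA c p.1.1 p.1.2 := by
  intro p
  rw [Submodule.disjoint_def]
  rintro _ ⟨x, hx, rfl⟩ h
  have hle : (⨆ q, ⨆ (_ : q ≠ p), dualPeirceSpace hA c q.1.1 q.1.2) ≤
      LinearMap.ker (dualTraceForm hA (flat hA x)) := by
    refine iSup₂_le fun q hq => ?_
    rintro _ ⟨y, hy, rfl⟩
    rw [LinearMap.mem_ker]
    refine (dualTraceForm_flat hA x y).trans (traceForm_eq_zero_of_mem_peirceSpace ?_ hx hy)
    exact fun h => hq (Subtype.ext (eq_of_sym2_eq_of_mem_activePairs q.2 p.2 h.symm))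
  have h0 := hle h
  rw [LinearMap.mem_ker] at h0
  have hx0 : x = 0 := hA.eq_zero ((dualTraceForm_flat hA x x).symm.trans h0)
  rw [hx0, map_zero]

end Regular

/-! ### Block decomposition of `H_ξ` and `G_ξ` -/

section Blocks

variable {A : Type*} [NonUnitalNonAssocCommRing A] [Module ℝ A] [IsScalarTower ℝ A A]
  [SMulCommClass ℝ A A] [FiniteDimensional ℝ A] [IsCommJordan A] {r : ℕ} {c : Fin r → A}
  {lam : Fin r → ℝ}

theorem dualDistribution_eq_iSup (hA : IsPositive A) (hc : IsJordanFrame c)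
    (hlam : ∀ p ∈ activePairs lam, lam p.1 + lam p.2 = 0 → ∀ x ∈ peirceSpace c p.1 p.2, x = 0) :
    dualDistribution (flat hA (∑ a, lam a • c a)) =
      ⨆ p : activePairs lam, dualPeirceSpace hA c p.1.1 p.1.2 := by
  apply le_antisymm
  · intro η hη
    obtain ⟨u, rfl⟩ := (mem_dualDistribution_flat hA).mp hη
    rw [← sum_peirceComponent hc u]
    simp only [Finset.mul_sum, map_sum]
    refine Submodule.sum_mem _ fun i _ => Submodule.sum_mem _ fun j _ => ?_
    have hmem := peirceComponent_mem hc i j u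
    rw [sum_smul_mul_of_mem_peirceSpace hmem, map_smul]
    by_cases h0 : lam i + lam j = 0
    · rw [h0, zero_div, zero_smul]
      exact zero_mem _
    refine Submodule.smul_mem _ _ ?_
    have hne : lam i ≠ 0 ∨ lam j ≠ 0 := by
      by_contra! h
      exact h0 (by rw [h.1, h.2, add_zero])
    rcases le_total i j with hij | hij
    · exact Submodule.mem_iSup_of_mem
        (⟨(i, j), mem_activePairs.mpr ⟨hij, hne⟩⟩ : activePairs lam) ⟨_, hmem, rfl⟩
    · rw [peirceSpace_comm] at hmem
      exact Submodule.mem_iSup_of_mem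
        (⟨(j, i), mem_activePairs.mpr ⟨hij, hne.symm⟩⟩ : activePairs lam) ⟨_, hmem, rfl⟩
  · refine iSup_le fun p => ?_
    rintro _ ⟨x, hx, rfl⟩
    refine (mem_dualDistribution_flat hA).mpr ⟨_, congrArg (flat hA)
      (sum_smul_mul_two_div_smul hx fun h => hlam p p.2 h x hx)⟩

theorem canonicalForm_of_mem_dualPeirceSpace (hA : IsPositive A) {a i b j : Fin r}
    (hai : lam a + lam i = 0 → ∀ x ∈ peirceSpace c a i, x = 0)
    (hbj : lam b + lam j = 0 → ∀ x ∈ peirceSpace c b j, x = 0)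
    {η ζ : dualDistribution (flat hA (∑ a, lam a • c a))}
    (hη : (η : Dual ℝ A) ∈ dualPeirceSpace hA c a i)
    (hζ : (ζ : Dual ℝ A) ∈ dualPeirceSpace hA c b j) :
    canonicalForm (flat hA (∑ a, lam a • c a)) η ζ =
      if s(a, i) = s(b, j) then
        2 / (lam a + lam i) * dualTraceForm hA (η : Dual ℝ A) ζ
      else 0 := by
  obtain ⟨x, hx, hxη⟩ := hη
  obtain ⟨y, hy, hyζ⟩ := hζ
  have ex := sum_smul_mul_two_div_smul hx fun h => hai h x hx
  have ey := sum_smul_mul_two_div_smul hy fun h => hbj h y hy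
  rw [canonicalForm_flat hA (hxη.symm.trans (congrArg (flat hA) ex.symm))
    (hyζ.symm.trans (congrArg (flat hA) ey.symm)), ex, map_smul, smul_eq_mul, ← hxη, ← hyζ]
  split_ifs with h
  · have hsum : lam b + lam j = lam a + lam i := by
      rcases Sym2.eq_iff.mp h with ⟨rfl, rfl⟩ | ⟨rfl, rfl⟩
      · rfl
      · exact add_comm _ _
    rw [hsum]
    exact congrArg _ (dualTraceForm_flat hA x y).symm
  · rw [traceForm_eq_zero_of_mem_peirceSpace h hx hy, mul_zero]

theorem canonicalForm_sum (hA : IsPositive A)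
    (hlam : ∀ p ∈ activePairs lam, lam p.1 + lam p.2 = 0 → ∀ x ∈ peirceSpace c p.1 p.2, x = 0)
    {η ζ : dualDistribution (flat hA (∑ a, lam a • c a))} {f g : Fin r × Fin r → Dual ℝ A}
    (hf : ∀ p ∈ activePairs lam, f p ∈ dualPeirceSpace hA c p.1 p.2)
    (hg : ∀ p ∈ activePairs lam, g p ∈ dualPeirceSpace hA c p.1 p.2)
    (hη : (η : Dual ℝ A) = ∑ p ∈ activePairs lam, f p)
    (hζ : (ζ : Dual ℝ A) = ∑ p ∈ activePairs lam, g p) :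
    canonicalForm (flat hA (∑ a, lam a • c a)) η ζ =
      ∑ p ∈ activePairs lam, 2 / (lam p.1 + lam p.2) * dualTraceForm hA (f p) (g p) := by
  have lift {f : Fin r × Fin r → Dual ℝ A}
      (hf : ∀ p ∈ activePairs lam, f p ∈ dualPeirceSpace hA c p.1 p.2) :
      ∃ x : Fin r × Fin r → A, ∀ p ∈ activePairs lam,
        x p ∈ peirceSpace c p.1 p.2 ∧ flat hA (x p) = f p :=
    ⟨fun p => (flat hA).symm (f p), fun p hp => by
      obtain ⟨x, hx, hxf⟩ := hf p hp
      have : (flat hA).symm (f p) = x := (flat hA).symm_apply_eq.mpr hxf.symm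
      change (flat hA).symm (f p) ∈ _ ∧ flat hA ((flat hA).symm (f p)) = f p
      rw [this]
      exact ⟨hx, hxf⟩⟩
  -- An explicit `l_z`-preimage turns `G_ξ` into a `τ`-pairing, whose cross terms vanish by
  -- orthogonality.
  have preimage {x : Fin r × Fin r → A} (hx : ∀ p ∈ activePairs lam, x p ∈ peirceSpace c p.1 p.2) :
      (∑ a, lam a • c a) * ∑ p ∈ activePairs lam, (2 / (lam p.1 + lam p.2)) • x p =
        ∑ p ∈ activePairs lam, x p := by
    rw [Finset.mul_sum]
    exact Finset.sum_congr rfl fun p hp =>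
      sum_smul_mul_two_div_smul (hx p hp) fun h => hlam p hp h _ (hx p hp)
  obtain ⟨x, hx⟩ := lift hf
  obtain ⟨y, hy⟩ := lift hg
  have hxz := preimage fun p hp => (hx p hp).1
  have hyz := preimage fun p hp => (hy p hp).1
  have eη : (η : Dual ℝ A) = flat hA (∑ p ∈ activePairs lam, x p) := by
    rw [hη, map_sum]
    exact Finset.sum_congr rfl fun p hp => (hx p hp).2.symm
  have eζ : (ζ : Dual ℝ A) = flat hA (∑ p ∈ activePairs lam, y p) := by
    rw [hζ, map_sum]
    exact Finset.sum_congr rfl fun p hp => (hy p hp).2.symm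
  rw [canonicalForm_flat hA (eη.trans (congrArg _ hxz.symm)) (eζ.trans (congrArg _ hyz.symm)),
    hxz, LinearMap.map_sum₂]
  refine Finset.sum_congr rfl fun p hp => ?_
  rw [map_sum, Finset.sum_eq_single p, map_smul, smul_eq_mul, ← (hx p hp).2, ← (hy p hp).2,
    dualTraceForm_flat]
  · intro q hq hqp
    rw [map_smul, traceForm_eq_zero_of_mem_peirceSpace
      (fun h => hqp (eq_of_sym2_eq_of_mem_activePairs hp hq h).symm) (hx p hp).1 (hy q hq).1,
      smul_zero]
  · exact fun h => absurd hp h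

end Blocks

end JordanMetric

theorem mainTheorem4 {J : Type*} [NonUnitalNonAssocCommRing J] [Module ℝ J]
    [IsScalarTower ℝ J J] [SMulCommClass ℝ J J] [FiniteDimensional ℝ J] [IsCommJordan J]
    (hJ : JordanMetric.IsPositive J) {r : ℕ} (c : Fin r → J) (hc : JordanMetric.IsJordanFrame c)
    (lam : Fin r → ℝ) (ξ : Module.Dual ℝ J) (hξ : ξ = ∑ a, lam a • JordanMetric.flat hJ (c a)) :
    -- the spectral condition implies regularity
    ((∀ a b, lam a ≠ 0 → lam b ≠ 0 → lam a + lam b ≠ 0) → JordanMetric.IsRegularPoint ξ) ∧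
    -- the description of the form at a regular point
    (JordanMetric.IsRegularPoint ξ →
      -- `H_ξ` is the direct sum of the dual Peirce spaces `J_{ai}^♭` with `λ_a ≠ 0`
      iSupIndep (fun p : JordanMetric.activePairs lam =>
        JordanMetric.dualPeirceSpace hJ c p.1.1 p.1.2) ∧
      JordanMetric.dualDistribution ξ =
        (⨆ p : JordanMetric.activePairs lam, JordanMetric.dualPeirceSpace hJ c p.1.1 p.1.2) ∧
      -- the denominators do not vanish on nonzero blocks
      (∀ a i, lam a ≠ 0 → JordanMetric.dualPeirceSpace hJ c a i ≠ ⊥ → lam a + lam i ≠ 0) ∧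
      -- the blockwise description of `G_ξ`
      (∀ a i, lam a ≠ 0 → ∀ b j, lam b ≠ 0 → ∀ η ζ : JordanMetric.dualDistribution ξ,
        (η : Module.Dual ℝ J) ∈ JordanMetric.dualPeirceSpace hJ c a i →
        (ζ : Module.Dual ℝ J) ∈ JordanMetric.dualPeirceSpace hJ c b j →
        JordanMetric.canonicalForm ξ η ζ =
          if s(a, i) = s(b, j) then
            2 / (lam a + lam i) * JordanMetric.dualTraceForm hJ (η : Module.Dual ℝ J) ζ
          else 0) ∧
      -- `G_ξ` as the sum over the blocks
      (∀ (η ζ : JordanMetric.dualDistribution ξ) (f g : Fin r × Fin r → Module.Dual ℝ J),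
        (∀ p ∈ JordanMetric.activePairs lam, f p ∈ JordanMetric.dualPeirceSpace hJ c p.1 p.2) →
        (∀ p ∈ JordanMetric.activePairs lam, g p ∈ JordanMetric.dualPeirceSpace hJ c p.1 p.2) →
        (η : Module.Dual ℝ J) = ∑ p ∈ JordanMetric.activePairs lam, f p →
        (ζ : Module.Dual ℝ J) = ∑ p ∈ JordanMetric.activePairs lam, g p →
        JordanMetric.canonicalForm ξ η ζ =
          ∑ p ∈ JordanMetric.activePairs lam,
            2 / (lam p.1 + lam p.2) * JordanMetric.dualTraceForm hJ (f p) (g p))) := by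
  subst hξ
  have hflat : ∑ a, lam a • JordanMetric.flat hJ (c a) =
      JordanMetric.flat hJ (∑ a, lam a • c a) := by
    simp only [map_sum, map_smul]
  rw [hflat]
  refine ⟨JordanMetric.isRegularPoint_of_add_ne_zero hJ hc, fun hreg => ?_⟩
  have hzero (a i : Fin r) (ha : lam a ≠ 0) (h : lam a + lam i = 0) :
      ∀ x ∈ JordanMetric.peirceSpace c a i, x = 0 := fun x hx =>
    hreg.eq_zero_of_mem_peirceSpace hJ hc ha h hx
  have hlam : ∀ p ∈ JordanMetric.activePairs lam, lam p.1 + lam p.2 = 0 →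
      ∀ x ∈ JordanMetric.peirceSpace c p.1 p.2, x = 0 := by
    intro p hp h
    rcases (JordanMetric.mem_activePairs.mp hp).2 with h1 | h1
    · exact hzero _ _ h1 h
    · rw [JordanMetric.peirceSpace_comm]
      exact hzero _ _ h1 (by rw [add_comm, h])
  refine ⟨JordanMetric.iSupIndep_dualPeirceSpace hJ c lam,
    JordanMetric.dualDistribution_eq_iSup hJ hc hlam, fun a i ha hne h => hne ?_,
    fun a i ha b j hb η ζ => JordanMetric.canonicalForm_of_mem_dualPeirceSpace hJ
      (hzero a i ha) (hzero b j hb),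
    fun η ζ f g => JordanMetric.canonicalForm_sum hJ hlam⟩
  rw [eq_bot_iff]
  rintro _ ⟨x, hx, rfl⟩
  rw [hzero a i ha h x hx, map_zero]
  exact zero_mem _
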